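/- Let $\Gamma$ be a finite simple graph and $G\le\mathrm{Aut}(\Gamma)$. Write $(\Gamma,G)\in\mathcal{OG}(4)$ if $\Gamma$ is connected, every vertex has valency $4$, and $G$ is transitive on the vertices and on the edges of $\Gamma$ but not on its arcs (ordered pairs of adjacent vertices). For a normal subgroup $N$ of $G$, let $\Gamma_N$ be the simple graph whose vertices are the $N$-orbits on $V\Gamma$, two distinct $N$-orbits being adjacent if and only if some edge of $\Gamma$ joins a vertex of one to a vertex of the other, and let $\tilde N$ be the kernel of the action of $G$ on the set of $N$-orbits. Let $\mathbf C_r$ denote the cycle of length $r$. A pair $(\Gamma,G)\in\mathcal{OG}(4)$ is *basic* if for every nontrivial normal subgroup $N$ of $G$ the graph $\Gamma_N$ is isomorphic to $K_1$, to $K_2$, or to $\mathbf C_r$ for some $r\ge 3$. A *cyclic normal quotient* of $(\Gamma,G)$ is a graph $\Gamma_N$, with $N$ a nontrivial normal subgroup of $G$, such that $\Gamma_N\cong\mathbf C_r$ for some $r\ge 3$; it is *$G$-oriented* if the group $G/\tilde N$ induced by $G$ on $\Gamma_N$ is the cyclic group of all $r$ rotations of this cycle. Two cyclic normal quotients $\Gamma_M,\Gamma_N$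 are *independent* if $\Gamma_K$, where $K=\tilde M\cap\tilde N$, is not a cycle of length at least $3$. A basic pair $(\Gamma,G)$ is *of oriented-cycle type* if it has at least one cyclic normal quotient, it has no two independent cyclic normal quotients, and all its cyclic normal quotients are $G$-oriented. For integers $v\ge 2$, $r\ge 3$ and $s\ge 1$, let $\overline{\mathbf C}_r(v,s)$ be the underlying undirected graph of the digraph with vertex set $\mathbb Z_r\times\mathbb Z_v^s$ that has an edge from $(i,(x_1,\dots,x_s))$ to $(j,(y_1,\dots,y_s))$ if and only if $j=i+1$ and $(y_1,\dots,y_s)=(y_1,x_1,\dots,x_{s-1})$. **Proposition.** Suppose that $(\Gamma,G)\in\mathcal{OG}(4)$ is basic of oriented-cycle type. Then either (a) $\Gamma\cong\overline{\mathbf C}_r(2,t)$ for some $r\ge 3$ and $t\ge 1$, or (b) $G$ has a unique minimal normal subgroup $N$, and $N\cong T^k$ for some simple group $T\not\cong\mathbb Z_2$ and some $k\ge 1$. -/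

import Mathlib

universe u

namespace OG4

section Oriented

variable {V : Type u} (Γ : SimpleGraph V) (G : Subgroup (Γ ≃g Γ))

/-- `G` is transitive on the vertices of `Γ`. -/
def VertexTransitive : Prop :=
  ∀ a b : V, ∃ g : G, g • a = b

/-- `G` is transitive on the (undirected) edges of `Γ`. -/
def EdgeTransitive : Prop :=
  ∀ a b c d : V, Γ.Adj a b → Γ.Adj c d → ∃ g : G, s(g • a, g • b) = s(c, d)

/-- `G` is transitive on the arcs (ordered pairs of adjacent vertices) of `Γ`. -/
def ArcTransitive : Prop :=
  ∀ a b c d : V, Γ.Adj a b → Γ.Adj c d → ∃ g : G, g • a = c ∧ g • b = d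

/-- `Γ` is `G`-oriented (also called `G`-half-arc-transitive). -/
def IsOriented : Prop :=
  VertexTransitive Γ G ∧ EdgeTransitive Γ G ∧ ¬ ArcTransitive Γ G

/-- The pair `(Γ, G)` belongs to the family `OG(m)`: `Γ` is finite, connected, `m`-valent and
`G`-oriented, where `G` is a subgroup of the automorphism group of `Γ`. -/
def MemOG (m : ℕ) : Prop :=
  Finite V ∧ Γ.Connected ∧ (∀ v : V, (Γ.neighborSet v).ncard = m) ∧ IsOriented Γ G

end Oriented

section Quotients

variable {V : Type u} {Γ : SimpleGraph V} {G : Subgroup (Γ ≃g Γ)}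

/-- The set of orbits on the vertices of `Γ` of a subgroup `N` of `G`. -/
abbrev Orbits (N : Subgroup G) : Type u :=
  MulAction.orbitRel.Quotient N V

/-- The `N`-orbit of a vertex, as a point of `Orbits N`. -/
def orbitOf (N : Subgroup G) (v : V) : Orbits N :=
  Quotient.mk (MulAction.orbitRel N V) v

/-- The quotient graph `Γ_N`: its vertices are the `N`-orbits, and two distinct `N`-orbits are
adjacent when some edge of `Γ` joins a vertex of one to a vertex of the other. -/
def quotientGraph (N : Subgroup G) : SimpleGraph (Orbits N) where
  Adj A B := A ≠ B ∧ ∃ a b : V, orbitOf N a = A ∧ orbitOf N b = B ∧ Γ.Adj a b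
  symm := ⟨fun _ _ h => by
    obtain ⟨hne, a, b, ha, hb, hab⟩ := h
    exact ⟨hne.symm, b, a, hb, ha, hab.symm⟩⟩
  loopless := ⟨fun _ h => h.1 rfl⟩

/-- A graph is a cycle `C_r` for some `r ≥ 3`. -/
def IsCycleGraph {W : Type u} (Δ : SimpleGraph W) : Prop :=
  ∃ r : ℕ, 3 ≤ r ∧ Nonempty (Δ ≃g SimpleGraph.cycleGraph r)

/-- A graph is one of `K_1`, `K_2`, or `C_r` with `r ≥ 3`. -/
def IsDegenerateGraph {W : Type u} (Δ : SimpleGraph W) : Prop :=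
  Nonempty (Δ ≃g SimpleGraph.completeGraph (Fin 1)) ∨
    Nonempty (Δ ≃g SimpleGraph.completeGraph (Fin 2)) ∨
    IsCycleGraph Δ

/-- `Γ_N` is a cyclic normal quotient of `(Γ, G)`. -/
def IsCyclicNormalQuotient (N : Subgroup G) : Prop :=
  N.Normal ∧ N ≠ ⊥ ∧ IsCycleGraph (quotientGraph N)

/-- The subgroup `Ñ` of all elements of `G` that fix every `N`-orbit setwise; for normal `N` it
is the kernel of the action of `G` on the set of `N`-orbits. -/
def orbitKernel (N : Subgroup G) : Subgroup G where
  carrier := {g | ∀ v : V, orbitOf N (g • v) = orbitOf N v}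
  one_mem' := fun v => by rw [one_smul]
  mul_mem' := fun {g h} hg hh v => by
    rw [mul_smul, hg (h • v), hh v]
  inv_mem' := fun {g} hg v => by
    have h := hg (g⁻¹ • v)
    rw [smul_inv_smul] at h
    exact h.symm

/-- The cyclic normal quotient `Γ_N` is `G`-oriented: for some `r ≥ 3` the pair
`(Γ_N, G/Ñ)` is isomorphic to `(C_r, C_r)`, that is, under some graph isomorphism of `Γ_N` with
the cycle on `Fin r`, the group induced by `G` on `Γ_N` is exactly the group of all
rotations `i ↦ i + c`. -/
def IsOrientedCyclicQuotient (N : Subgroup G) : Prop :=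
  ∃ r : ℕ, 3 ≤ r ∧ ∃ φ : quotientGraph N ≃g SimpleGraph.cycleGraph r,
    (∀ g : G, ∃ c : Fin r, ∀ v : V, φ (orbitOf N (g • v)) = φ (orbitOf N v) + c) ∧
    (∀ c : Fin r, ∃ g : G, ∀ v : V, φ (orbitOf N (g • v)) = φ (orbitOf N v) + c)

/-- Two normal quotients `Γ_M`, `Γ_N` are independent if `Γ_K`, with `K = M̃ ∩ Ñ`, is not
a cycle. -/
def Independent (M N : Subgroup G) : Prop :=
  ¬ IsCycleGraph (quotientGraph (orbitKernel M ⊓ orbitKernel N))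

variable (Γ G) in
/-- A member `(Γ, G)` of `OG(4)` is basic if the normal quotient `Γ_N` is degenerate for every
nontrivial normal subgroup `N` of `G`. -/
def IsBasic : Prop :=
  MemOG Γ G 4 ∧ ∀ N : Subgroup G, N.Normal → N ≠ ⊥ → IsDegenerateGraph (quotientGraph N)

variable (Γ G) in
/-- `(Γ, G)` is basic of oriented-cycle type: it is basic, it has a cyclic normal quotient, it has
no independent cyclic normal quotients, and all its cyclic normal quotients are `G`-oriented. -/
def IsBasicOrientedCycle : Prop :=
  IsBasic Γ G ∧
  (∃ N : Subgroup G, IsCyclicNormalQuotient N) ∧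
  (∀ M N : Subgroup G, IsCyclicNormalQuotient M → IsCyclicNormalQuotient N →
    ¬ Independent M N) ∧
  (∀ N : Subgroup G, IsCyclicNormalQuotient N → IsOrientedCyclicQuotient N)

end Quotients

/-- The digraph `C_r(v, s)` on `ZMod r × (ZMod v)^s`, with an edge from `(i, x)` to `(j, y)` if
and only if `j = i + 1` and `y = (y_1, x_1, …, x_{s-1})`. -/
def cycleDigraph (r v s : ℕ) : Digraph (ZMod r × (Fin s → ZMod v)) where
  Adj p q := q.1 = p.1 + 1 ∧ ∀ m n : Fin s, (n : ℕ) = (m : ℕ) + 1 → q.2 n = p.2 m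

/-- The underlying graph `C̄_r(v, s)` of the digraph `C_r(v, s)`. -/
def cycleDigraphUnderlying (r v s : ℕ) : SimpleGraph (ZMod r × (Fin s → ZMod v)) :=
  (cycleDigraph r v s).toSimpleGraphInclusive

/-- `N` is a minimal normal subgroup of the group `H`. -/
def IsMinimalNormal {H : Type u} [Group H] (N : Subgroup H) : Prop :=
  N.Normal ∧ N ≠ ⊥ ∧ ∀ M : Subgroup H, M.Normal → M ≠ ⊥ → M ≤ N → M = N

end OG4

/-!
Since no two cyclic normal quotients are independent, the kernels of `G` on the cyclic normal
quotients have a least element `K`, and `Γ_K` is a cycle (`exists_least_orbitKernel`). The cycle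
orients `Γ` with out-valency and in-valency 2, and `G` is transitive on the arcs of this orientation
and contains only rotations of the cycle, so that vertex stabilizers are 2-groups contained in `K`.
A nontrivial normal subgroup of `G` contained in `K` has the same orbits as `K`, because its
quotient maps onto `Γ_K`, hence is itself a cycle, and its kernel contains `K`.

Suppose that `K` is a 2-group. Its centre is normal in `G`, so it is transitive on each `K`-orbit;
then `K` induces on each orbit the group induced by its centre, and `K` is abelian. The orientation
of `Γ` is now a `SwapDigraph`: the stabilizer in the abelian group `K` of a vertex swaps the two
out-neighbours, and in-neighbours of a common vertex lie in one `K`-orbit. Consequently two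
in-neighbours of a vertex have the same out-neighbours. Identifying vertices with the same
out-neighbours gives a smaller digraph of the same kind, which by induction is some `C_r(2, t)`, a
directed cycle being the case `t = 0`; the original digraph is recovered as its line digraph, which
is `C_r(2, t + 1)` (`SwapDigraph.exists_equiv`).

Suppose that `K` is not a 2-group. If `M` and `L` are normal subgroups meeting trivially and the
squares of the elements of `L` preserve the `M`-orbits, then `L` is a 2-group: for `l ∈ L` some
`m⁻¹ * l ^ 2` with `m ∈ M` fixes a vertex, so it has 2-power order, and `m` and `l` commute. Taking
`L = K`, every minimal normal subgroup of `G` lies in `K`; taking both in `K`, two distinct minimal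
normal subgroups would be 2-groups. A minimal normal 2-subgroup would make `K` a 2-group, since `K`
has the same orbits. So there is exactly one minimal normal subgroup, it is not a 2-group, and it is
a power of a simple group, as are all minimal normal subgroups of finite groups
(`IsMinimalNormal.exists_mulEquiv_pi`).
-/

namespace OG4

/-! ### Digraphs with a commutative group swapping out-neighbours -/

section DigraphLemma

/-- Two vertices are twins when they have the same out-neighbours. -/
def twinSetoid {V : Type*} (A : V → V → Prop) : Setoid V where
  r v w := ∀ x, A v x ↔ A w x
  iseqv := ⟨fun _ _ => Iff.rfl, fun h x => (h x).symm, fun h₁ h₂ x => (h₁ x).trans (h₂ x)⟩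

/-- `G` acts vertex-transitively by automorphisms on the connected digraph `A`, every vertex has one
or two out-neighbours, and `K` is a commutative subgroup of `G` such that the stabilizer in `K` of a
vertex is transitive on its out-neighbours and the in-neighbours of a vertex lie in one
`K`-orbit. -/
structure SwapDigraph {V G : Type*} [Group G] [MulAction G V] (A : V → V → Prop)
    (K : Subgroup G) : Prop where
  map_adj : ∀ (g : G) {v w : V}, A v w → A (g • v) (g • w)
  trans : ∀ v w : V, ∃ g : G, g • v = w
  comm : ∀ a ∈ K, ∀ b ∈ K, a * b = b * a
  swap : ∀ {v w w' : V}, A v w → A v w' → ∃ k ∈ K, k • v = v ∧ k • w = w'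
  pred : ∀ {v v' w : V}, A v w → A v' w → ∃ k ∈ K, k • v = v'
  out : ∀ v : V, ∃ w w', ∀ x, A v x ↔ x = w ∨ x = w'
  conn : ∀ v w : V, Relation.EqvGen A v w

variable {V G : Type*} [Group G] [MulAction G V] {A : V → V → Prop} {K : Subgroup G}

namespace SwapDigraph

lemma adj_iff (h : SwapDigraph A K) (g : G) {v w : V} : A (g • v) (g • w) ↔ A v w :=
  ⟨fun hh => by simpa using h.map_adj g⁻¹ hh, h.map_adj g⟩

/-- In-neighbours of a common vertex are twins: the stabilizer of one of them in the commutative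
group `K` is also the stabilizer of the other one. -/
lemma twin_of_adj (h : SwapDigraph A K) {v v' w : V} (hv : A v w) (hv' : A v' w) (x : V) :
    A v x ↔ A v' x := by
  have key : ∀ {v v' : V}, A v w → A v' w → A v x → A v' x := by
    intro v v' hv hv' hx
    obtain ⟨k, hk, rfl⟩ := h.pred hv hv'
    obtain ⟨l, hl, hlv, rfl⟩ := h.swap hv hx
    have := h.map_adj l hv'
    rwa [← mul_smul, h.comm l hl k hk, mul_smul, hlv] at this
  exact ⟨key hv hv', key hv' hv⟩

lemma exists_adj (h : SwapDigraph A K) (v : V) : ∃ w, A v w := by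
  obtain ⟨w, w', hw⟩ := h.out v
  exact ⟨w, (hw w).2 (Or.inl rfl)⟩

lemma exists_pred (h : SwapDigraph A K) (w : V) : ∃ v, A v w := by
  obtain ⟨x, hx⟩ := h.exists_adj w
  obtain ⟨g, hg⟩ := h.trans x w
  have := h.map_adj g hx
  rw [hg] at this
  exact ⟨g • w, this⟩

/-- The action of the group on the classes of twins. -/
@[reducible] def twinAction (h : SwapDigraph A K) : MulAction G (Quotient (twinSetoid A)) where
  smul g := Quotient.map (g • ·) fun v w hvw x => by
    have := hvw (g⁻¹ • x)
    rw [← h.adj_iff g, ← h.adj_iff g (v := w), smul_inv_smul] at this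
    exact this
  one_smul X := by
    induction X using Quotient.inductionOn with
    | h v => exact congrArg (Quotient.mk _) (one_smul G v)
  mul_smul g g' X := by
    induction X using Quotient.inductionOn with
    | h v => exact congrArg (Quotient.mk _) (mul_smul g g' v)

/-- The digraph induced on the classes of twins. -/
def twinAdj (A : V → V → Prop) (X Y : Quotient (twinSetoid A)) : Prop :=
  ∃ v w, Quotient.mk _ v = X ∧ Quotient.mk _ w = Y ∧ A v w

lemma twinAdj_mk {v w : V} (hvw : A v w) :
    twinAdj A (Quotient.mk _ v) (Quotient.mk _ w) := ⟨v, w, rfl, rfl, hvw⟩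

lemma exists_of_twinAdj {v : V} {Y : Quotient (twinSetoid A)}
    (hY : twinAdj A (Quotient.mk _ v) Y) : ∃ w, A v w ∧ Quotient.mk _ w = Y := by
  obtain ⟨v', w, hv, hw, hA⟩ := hY
  exact ⟨w, (Quotient.exact hv w).1 hA, hw⟩

/-- Swap digraphs are inherited by the digraph of twin classes; its out-valency may drop to 1. -/
lemma twin (h : SwapDigraph A K) :
    letI := h.twinAction
    SwapDigraph (twinAdj A) K := by
  let := h.twinAction
  refine ⟨?_, ?_, h.comm, ?_, ?_, ?_, ?_⟩
  · rintro g _ _ ⟨v, w, rfl, rfl, hvw⟩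
    exact twinAdj_mk (h.map_adj g hvw)
  · intro X Y
    induction X using Quotient.inductionOn with | h v => ?_
    induction Y using Quotient.inductionOn with | h w => ?_
    obtain ⟨g, hg⟩ := h.trans v w
    exact ⟨g, congrArg (Quotient.mk _) hg⟩
  · intro X Y Z hY hZ
    induction X using Quotient.inductionOn with | h v => ?_
    obtain ⟨w, hw, rfl⟩ := exists_of_twinAdj hY
    obtain ⟨w', hw', rfl⟩ := exists_of_twinAdj hZ
    obtain ⟨k, hk, h₁, h₂⟩ := h.swap hw hw'
    exact ⟨k, hk, congrArg (Quotient.mk _) h₁, congrArg (Quotient.mk _) h₂⟩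
  · rintro _ _ _ ⟨v, w, rfl, rfl, hvw⟩ ⟨v', w', rfl, hww, hvw'⟩
    obtain ⟨x, hx⟩ := h.exists_adj w
    have hx' : A w' x := (Quotient.exact hww x).2 hx
    obtain ⟨k, hk, rfl⟩ := h.pred hx hx'
    exact ⟨k, hk, Quotient.sound (h.twin_of_adj (h.map_adj k hvw) hvw')⟩
  · intro X
    induction X using Quotient.inductionOn with | h v => ?_
    obtain ⟨w, w', hw⟩ := h.out v
    refine ⟨Quotient.mk _ w, Quotient.mk _ w', fun Y => ⟨fun hY => ?_, ?_⟩⟩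
    · obtain ⟨x, hx, rfl⟩ := exists_of_twinAdj hY
      exact ((hw x).1 hx).imp (congrArg _) (congrArg _)
    · rintro (rfl | rfl)
      exacts [twinAdj_mk ((hw w).2 (Or.inl rfl)), twinAdj_mk ((hw w').2 (Or.inr rfl))]
  · intro X Y
    induction X using Quotient.inductionOn with | h v => ?_
    induction Y using Quotient.inductionOn with | h w => ?_
    induction h.conn v w with
    | rel x y hxy => exact .rel _ _ (twinAdj_mk hxy)
    | refl x => exact .refl _
    | symm x y _ ih => exact .symm _ _ ih
    | trans x y z _ _ ih₁ ih₂ => exact .trans _ _ _ ih₁ ih₂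

/-- Vertices with two out-neighbours force distinct twins, by counting arcs. -/
lemma card_twin_lt [Finite V] [Nonempty V]
    (h : SwapDigraph A K) (h2 : ∀ v, ∃ w w', w ≠ w' ∧ A v w ∧ A v w') :
    Nat.card (Quotient (twinSetoid A)) < Nat.card V := by
  have hsurj : Function.Surjective (Quotient.mk (twinSetoid A)) := Quotient.mk_surjective
  refine lt_of_le_of_ne (Nat.card_le_card_of_surjective _ hsurj) fun hcard => ?_
  have hinj : Function.Injective (Quotient.mk (twinSetoid A)) :=
    (hsurj.bijective_of_nat_card_le hcard.ge).1
  choose f f' hne hf hf' using h2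
  have uniq : ∀ {v v' w : V}, A v w → A v' w → v = v' := fun hv hv' =>
    hinj (Quotient.sound (h.twin_of_adj hv hv'))
  have hf'inj : Function.Injective f' := fun a b hab => uniq (hf' a) (hab ▸ hf' b)
  obtain ⟨v⟩ := ‹Nonempty V›
  obtain ⟨b, hb⟩ := (Finite.surjective_of_injective hf'inj) (f v)
  have : b = v := uniq (hb ▸ hf' b) (hf v)
  exact hne v (this ▸ hb.symm)

/-- A connected digraph in which every vertex has exactly one out-neighbour and at least one
in-neighbour is a directed cycle. -/
lemma exists_equiv_of_out_one [Finite V] [Nonempty V] (h : SwapDigraph A K)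
    (h1 : ∀ v w w', A v w → A v w' → w = w') :
    ∃ r : ℕ, 0 < r ∧ ∃ e : V ≃ ZMod r × (Fin 0 → ZMod 2),
      ∀ v w, A v w ↔ (cycleDigraph r 2 0).Adj (e v) (e w) := by
  choose f hf using h.exists_adj
  have hA : ∀ v w, A v w ↔ f v = w := fun v w => ⟨h1 v _ _ (hf v), fun e => e ▸ hf v⟩
  have hsurj : Function.Surjective f := fun w => by
    obtain ⟨v, hv⟩ := h.exists_pred w
    exact ⟨v, (hA v w).1 hv⟩
  let σ : Equiv.Perm V :=
    Equiv.ofBijective f (Finite.injective_iff_surjective.2 hsurj).bijective_of_finite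
  obtain ⟨v₀⟩ := ‹Nonempty V›
  have horb : ∀ v, v ∈ MulAction.orbit (Subgroup.zpowers σ) v₀ := by
    have : ∀ v w, Relation.EqvGen A v w →
        MulAction.orbitRel (Subgroup.zpowers σ) V v w := by
      intro v w hvw
      induction hvw with
      | rel x y hxy =>
        refine Setoid.symm' _ ⟨⟨σ, Subgroup.mem_zpowers σ⟩, (hA x y).1 hxy⟩
      | refl x => exact Setoid.refl' _ x
      | symm x y _ ih => exact Setoid.symm' _ ih
      | trans x y z _ _ ih₁ ih₂ => exact Setoid.trans' _ ih₁ ih₂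
    exact fun v => this v v₀ (h.conn v v₀)
  let r := Function.minimalPeriod (σ • ·) v₀
  have hr : 0 < r := Function.minimalPeriod_pos_of_mem_periodicPts (by
    exact Function.Injective.mem_periodicPts (MulAction.injective σ) v₀)
  let e₀ := MulAction.orbitZPowersEquiv σ v₀
  let e₁ : V ≃ MulAction.orbit (Subgroup.zpowers σ) v₀ :=
    (Equiv.subtypeUnivEquiv (p := (· ∈ MulAction.orbit (Subgroup.zpowers σ) v₀)) horb).symm
  have key : ∀ i : ZMod r, σ ((e₁.trans e₀).symm i) = (e₁.trans e₀).symm (i + 1) := by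
    intro i
    obtain ⟨n, rfl⟩ := ZMod.intCast_surjective i
    have h₁ : ∀ n : ℤ, (e₁.trans e₀).symm (n : ZMod r) = (σ ^ n) v₀ := fun n => by
      have := MulAction.orbitZPowersEquiv_symm_apply' σ v₀ n
      exact congrArg Subtype.val this
    rw [h₁, ← Int.cast_one, ← Int.cast_add, h₁, add_comm, zpow_add, zpow_one]
    rfl
  refine ⟨r, hr, (e₁.trans e₀).trans (Equiv.prodUnique _ _).symm, fun v w => ?_⟩
  rw [hA]
  have hk := key ((e₁.trans e₀) v)
  rw [Equiv.symm_apply_apply] at hk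
  change σ v = w ↔ (e₁.trans e₀) w = (e₁.trans e₀) v + 1 ∧ _
  rw [hk, Equiv.symm_apply_eq, eq_comm]
  exact ⟨fun hh => ⟨hh, fun m => m.elim0⟩, And.left⟩

/-- The inductive step: if the digraph of twin classes is `C_r(2, t)` then the digraph itself
is `C_r(2, t + 1)`. -/
lemma exists_equiv_succ (h : SwapDigraph A K) (h2 : ∀ v, ∃ w w', w ≠ w' ∧ A v w ∧ A v w')
    {r t : ℕ} (e : Quotient (twinSetoid A) ≃ ZMod r × (Fin t → ZMod 2))
    (he : ∀ X Y, twinAdj A X Y ↔ (cycleDigraph r 2 t).Adj (e X) (e Y)) :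
    ∃ e' : V ≃ ZMod r × (Fin (t + 1) → ZMod 2),
      ∀ v w, A v w ↔ (cycleDigraph r 2 (t + 1)).Adj (e' v) (e' w) := by
  choose u hu using h.exists_pred
  -- `p w` is the class formed by the in-neighbours of `w`
  let p : V → Quotient (twinSetoid A) := fun w => Quotient.mk _ (u w)
  have hp : ∀ v w, A v w ↔ p w = Quotient.mk _ v := fun v w =>
    ⟨fun hvw => Quotient.sound (h.twin_of_adj (hu w) hvw),
      fun hvw => (Quotient.exact hvw w).1 (hu w)⟩
  have hB : ∀ w, (cycleDigraph r 2 t).Adj (e (p w)) (e (Quotient.mk _ w)) := fun w =>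
    (he _ _).1 (twinAdj_mk (hu w))
  -- a new coordinate that separates the two out-neighbours of each vertex
  obtain ⟨bit, hbit, hbit0⟩ : ∃ bit : V → ZMod 2, (∀ v b, ∃ w, A v w ∧ bit w = b) ∧
      ∀ w (m : Fin t), (m : ℕ) = 0 → bit w = (e (Quotient.mk _ w)).2 m := by
    rcases t with _ | t
    · choose f f' hne hf hf' using h2
      classical
      have hc : ∀ X : Quotient (twinSetoid A), ∃ v, Quotient.mk _ v = X := Quotient.exists_rep
      choose c hc using hc
      refine ⟨fun w => if w = f (c (p w)) then 0 else 1, fun v b => ?_, fun w m => m.elim0⟩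
      have hs := fun x => Quotient.exact (hc (Quotient.mk _ v)) x
      have h₁ := (hs _).1 (hf (c (Quotient.mk _ v)))
      have h₂ := (hs _).1 (hf' (c (Quotient.mk _ v)))
      have hb : b = 0 ∨ b = 1 := by revert b; decide
      rcases hb with rfl | rfl
      · exact ⟨_, h₁, by simp only [(hp _ _).1 h₁, if_true]⟩
      · exact ⟨_, h₂, by simp only [(hp _ _).1 h₂, if_neg (hne _).symm]⟩
    · refine ⟨fun w => (e (Quotient.mk _ w)).2 0, fun v b => ?_, fun w m hm => ?_⟩
      · have : twinAdj A (Quotient.mk _ v) (e.symm ((e (Quotient.mk _ v)).1 + 1,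
            Fin.cons b (Fin.init (e (Quotient.mk _ v)).2))) := by
          rw [he, Equiv.apply_symm_apply]
          refine ⟨rfl, fun m n hmn => ?_⟩
          obtain ⟨n, rfl⟩ := Fin.exists_succ_eq.2 (show n ≠ 0 by rintro rfl; simp at hmn)
          have : m = n.castSucc := Fin.ext (by simpa using hmn.symm)
          subst this
          simp [Fin.init]
        obtain ⟨w, hw, hw'⟩ := exists_of_twinAdj this
        exact ⟨w, hw, by simp [hw']⟩
      · rw [show m = 0 from Fin.ext hm]
  have hsep : ∀ {v w w'}, A v w → A v w' → bit w = bit w' → w = w' := by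
    intro v w w' hw hw' hb
    obtain ⟨x, hx, hxb⟩ := hbit v (bit w + 1)
    have hne : bit w ≠ bit w + 1 := by simp
    have hxw : w ≠ x := by rintro rfl; exact hne hxb
    have hxw' : w' ≠ x := by rintro rfl; exact hne (hb.trans hxb)
    obtain ⟨a, a', ha⟩ := h.out v
    rw [ha] at hw hw' hx
    grind
  let F : V → ZMod r × (Fin (t + 1) → ZMod 2) := fun v =>
    ((e (Quotient.mk _ v)).1, Fin.cons (bit v) (e (p v)).2)
  have hinj : Function.Injective F := by
    intro v w hvw
    obtain ⟨h₁, h₂⟩ := Prod.ext_iff.1 hvw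
    have h₃ : bit v = bit w ∧ (e (p v)).2 = (e (p w)).2 :=
      Fin.cons_injective2 (α := fun _ => ZMod 2) h₂
    have h₄ : p v = p w := e.injective (Prod.ext (by
      have := (hB v).1.symm.trans (h₁.trans (hB w).1)
      exact add_right_cancel this) h₃.2)
    exact hsep (hu v) ((hp _ _).2 h₄.symm) h₃.1
  have hsurj : Function.Surjective F := by
    rintro ⟨i, x⟩
    obtain ⟨v, hv⟩ := Quotient.exists_rep (e.symm (i - 1, Fin.tail x))
    obtain ⟨w, hw, hwb⟩ := hbit v (x 0)
    have hpw : e (p w) = (i - 1, Fin.tail x) := by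
      rw [(hp _ _).1 hw, ← Equiv.eq_symm_apply]; exact hv
    refine ⟨w, Prod.ext ?_ ?_⟩
    · change (e (Quotient.mk _ w)).1 = i
      rw [(hB w).1, hpw, sub_add_cancel]
    · change (Fin.cons (bit w) (e (p w)).2 : Fin (t + 1) → ZMod 2) = x
      rw [hpw, hwb, Fin.cons_self_tail]
  -- the first `t` coordinates of `F v` are those of the class of `v`
  have hinit : ∀ v (m : Fin t), (F v).2 m.castSucc = (e (Quotient.mk _ v)).2 m := by
    intro v m
    rcases t with _ | t
    · exact m.elim0
    · induction m using Fin.cases with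
      | zero => exact hbit0 v 0 rfl
      | succ m =>
        rw [(hB v).2 m.castSucc m.succ (by simp), ← Fin.succ_castSucc]
        rfl
  refine ⟨Equiv.ofBijective F ⟨hinj, hsurj⟩, fun v w => ?_⟩
  rw [hp, ← e.apply_eq_iff_eq, Prod.ext_iff]
  refine and_congr ?_ ?_
  · change _ ↔ (e (Quotient.mk _ w)).1 = (e (Quotient.mk _ v)).1 + 1
    rw [(hB w).1, add_left_inj]
  · rw [funext_iff]
    constructor
    · intro hvw m n hmn
      obtain ⟨n, rfl⟩ := Fin.exists_succ_eq.2 (show n ≠ 0 by rintro rfl; simp at hmn)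
      have : m = n.castSucc := Fin.ext (by simpa using hmn.symm)
      subst this
      exact (hvw n).trans (hinit v n).symm
    · intro hvw m
      exact (hvw m.castSucc m.succ (by simp)).trans (hinit v m)

/-- A finite swap digraph is one of the digraphs `C_r(2, t)`, where `t = 0` stands for the directed
cycle. -/
theorem exists_equiv {V G : Type*} [Group G] [Finite V] [Nonempty V] [MulAction G V]
    {A : V → V → Prop} {K : Subgroup G} (h : SwapDigraph A K) :
    ∃ r t : ℕ, 0 < r ∧ ∃ e : V ≃ ZMod r × (Fin t → ZMod 2),
      ∀ v w, A v w ↔ (cycleDigraph r 2 t).Adj (e v) (e w) := by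
  induction hn : Nat.card V using Nat.strong_induction_on generalizing V with
  | _ n ih =>
  by_cases h1 : ∀ v w w', A v w → A v w' → w = w'
  · obtain ⟨r, hr, e, he⟩ := h.exists_equiv_of_out_one h1
    exact ⟨r, 0, hr, e, he⟩
  · push Not at h1
    obtain ⟨v, w, w', hw, hw', hne⟩ := h1
    have h2 : ∀ v, ∃ w w', w ≠ w' ∧ A v w ∧ A v w' := fun x => by
      obtain ⟨g, rfl⟩ := h.trans v x
      exact ⟨g • w, g • w', fun hh => hne (MulAction.injective g hh), h.map_adj g hw,
        h.map_adj g hw'⟩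
    let := h.twinAction
    have : Nonempty (Quotient (twinSetoid A)) := ⟨Quotient.mk _ v⟩
    obtain ⟨r, t, hr, e, he⟩ := ih _ (hn ▸ h.card_twin_lt h2) h.twin rfl
    obtain ⟨e', he'⟩ := h.exists_equiv_succ h2 e he
    exact ⟨r, t + 1, hr, e', he'⟩

end SwapDigraph

end DigraphLemma

/-! ### Minimal normal subgroups of finite groups -/

section MinimalNormal

lemma exists_isMinimalNormal_le {H : Type u} [Group H] [Finite H] {K : Subgroup H} (hK : K.Normal)
    (hK1 : K ≠ ⊥) : ∃ N : Subgroup H, IsMinimalNormal N ∧ N ≤ K := by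
  obtain ⟨N, ⟨⟨hN, hN1⟩, hNK⟩, hmin⟩ :=
    (Set.toFinite {N : Subgroup H | (N.Normal ∧ N ≠ ⊥) ∧ N ≤ K}).exists_minimal
      ⟨K, ⟨hK, hK1⟩, le_rfl⟩
  exact ⟨N, ⟨hN, hN1, fun M hM hM1 hMN =>
    le_antisymm hMN (hmin ⟨⟨hM, hM1⟩, hMN.trans hNK⟩ hMN)⟩, hNK⟩

lemma IsMinimalNormal.le_or_disjoint {H : Type u} [Group H] {N : Subgroup H}
    (hN : IsMinimalNormal N) {M : Subgroup H} (hM : M.Normal) : N ≤ M ∨ Disjoint N M := by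
  by_cases h : N ⊓ M = ⊥
  · exact Or.inr (disjoint_iff.2 h)
  · have := hN.1
    exact Or.inl (inf_eq_left.1 (hN.2.2 _ inferInstance h inf_le_left))

lemma IsMinimalNormal.map {H : Type u} [Group H] {T : Subgroup H} (hT : IsMinimalNormal T)
    (f : H ≃* H) : IsMinimalNormal (T.map f.toMonoidHom) := by
  refine ⟨hT.1.map _ f.surjective, ?_, fun M hM hM1 hMT => ?_⟩
  · rw [Ne, Subgroup.map_eq_bot_iff_of_injective _ f.injective]
    exact hT.2.1
  · have := hT.2.2 (M.comap f.toMonoidHom) (hM.comap _) ?_ ?_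
    · rw [← this, Subgroup.map_comap_eq_self_of_surjective f.surjective]
    · intro h
      apply hM1
      rw [← Subgroup.map_comap_eq_self_of_surjective (f := f.toMonoidHom) f.surjective M, h,
        Subgroup.map_bot]
    · rintro x hx
      obtain ⟨y, hy, hyx⟩ := hMT hx
      rwa [← f.injective hyx]

variable {H : Type u} [Group H] {N : Subgroup H}

/-- The conjugates of a nontrivial subgroup of a minimal normal subgroup generate it. -/
lemma IsMinimalNormal.iSup_conj_eq_top (hN : IsMinimalNormal N) [N.Normal] {T : Subgroup N}
    (hT : T ≠ ⊥) : ⨆ g : H, T.map (MulAut.conjNormal g : N ≃* N).toMonoidHom = ⊤ := by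
  set S : Subgroup N := ⨆ g : H, T.map (MulAut.conjNormal g : N ≃* N).toMonoidHom with hS
  have hle : ∀ g : H, S.map (MulAut.conjNormal g : N ≃* N).toMonoidHom ≤ S := by
    intro g
    rw [hS, Subgroup.map_iSup]
    refine iSup_le fun g' => ?_
    rw [Subgroup.map_map]
    refine le_trans (le_of_eq ?_) (le_iSup _ (g * g'))
    rw [map_mul]
    rfl
  have hnorm : (S.map N.subtype).Normal := by
    refine ⟨?_⟩
    rintro _ ⟨x, hx, rfl⟩ g
    exact ⟨MulAut.conjNormal g x, hle g ⟨x, hx, rfl⟩, MulAut.conjNormal_apply g x⟩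
  have hTS : T ≤ S := by
    refine le_trans (le_of_eq ?_) (le_iSup _ (1 : H))
    rw [map_one]
    exact (Subgroup.map_id T).symm
  have h1 : S.map N.subtype ≠ ⊥ := by
    rw [Ne, Subgroup.map_eq_bot_iff_of_injective _ N.subtype_injective]
    exact fun h => hT (le_bot_iff.1 (h ▸ hTS))
  have h2 := hN.2.2 _ hnorm h1 (Subgroup.map_subtype_le S)
  apply Subgroup.map_injective N.subtype_injective
  rw [h2, ← MonoidHom.range_eq_map, N.range_subtype]

/-- A minimal normal subgroup `T` of a minimal normal subgroup `N` is simple: `N` is generated by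
`T` and by conjugates of `T` that centralize `T`, and all of them normalize every normal subgroup
of `T`. -/
lemma IsMinimalNormal.isSimpleGroup (hN : IsMinimalNormal N) {T : Subgroup N}
    (hT : IsMinimalNormal T) : IsSimpleGroup T := by
  have := hN.1
  have : Nontrivial T := T.nontrivial_iff_ne_bot.2 hT.2.1
  refine ⟨fun M hM => ?_⟩
  have hnorm : Subgroup.normalizer (M.map T.subtype : Set N) = ⊤ := by
    rw [eq_top_iff, ← hN.iSup_conj_eq_top hT.2.1]
    refine iSup_le fun g => ?_
    have hg := hT.map (MulAut.conjNormal g : N ≃* N)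
    rcases hT.le_or_disjoint hg.1 with hle | hdis
    · rw [← hg.2.2 T hT.1 hT.2.1 hle]
      intro t ht
      rw [Subgroup.mem_normalizer_iff]
      intro n
      constructor
      · rintro ⟨x, hx, rfl⟩
        exact ⟨_, hM.conj_mem x hx ⟨t, ht⟩, rfl⟩
      · rintro ⟨x, hx, hxn⟩
        refine ⟨_, hM.conj_mem x hx ⟨t, ht⟩⁻¹, ?_⟩
        change t⁻¹ * T.subtype x * t⁻¹⁻¹ = n
        rw [hxn]
        group
    · intro t ht
      have hc : ∀ x ∈ T, t * x * t⁻¹ = x := fun x hx => by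
        rw [← (Subgroup.commute_of_normal_of_disjoint _ _ hT.1 hg.1 hdis x t hx ht).eq,
          mul_inv_cancel_right]
      rw [Subgroup.mem_normalizer_iff]
      have hMT : ∀ x ∈ M.map T.subtype, x ∈ T := fun x hx => Subgroup.map_subtype_le M hx
      intro n
      refine ⟨fun hn => (hc n (hMT n hn)).symm ▸ hn, fun hn => ?_⟩
      have := hc _ (hMT _ hn)
      rw [mul_left_inj, mul_right_inj] at this
      rwa [this] at hn
  have hMN : (M.map T.subtype).Normal := Subgroup.normalizer_eq_top_iff.1 hnorm
  rcases eq_or_ne (M.map T.subtype) ⊥ with h | h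
  · exact Or.inl ((Subgroup.map_eq_bot_iff_of_injective _ T.subtype_injective).1 h)
  · right
    have := hT.2.2 _ hMN h (Subgroup.map_subtype_le M)
    apply Subgroup.map_injective T.subtype_injective
    rw [this, ← MonoidHom.range_eq_map, T.range_subtype]

/-- A minimal normal subgroup of a finite group is a power of a simple group. -/
theorem IsMinimalNormal.exists_mulEquiv_pi [Finite H] (hN : IsMinimalNormal N) :
    ∃ (T : Type u) (_ : Group T) (k : ℕ), IsSimpleGroup T ∧ 1 ≤ k ∧
      Nonempty (N ≃* (Fin k → T)) := by
  have := hN.1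
  have : Nontrivial N := N.nontrivial_iff_ne_bot.2 hN.2.1
  obtain ⟨T, hT, -⟩ := exists_isMinimalNormal_le (H := N) (K := ⊤) inferInstance bot_ne_top.symm
  have hsimple := hN.isSimpleGroup hT
  refine ⟨T, inferInstance, ?_⟩
  -- a largest normal subgroup of `N` that is a power of `T` contains all conjugates of `T`
  let S : Set (Subgroup N) := {P | P.Normal ∧ ∃ k : ℕ, ∃ f : (Fin k → T) →* N,
    Function.Injective f ∧ f.range = P}
  obtain ⟨P, ⟨hP, k, f, hf, hfP⟩, hmax⟩ := (Set.toFinite S).exists_maximal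
    ⟨⊥, inferInstance, 0, 1, Function.injective_of_subsingleton _, MonoidHom.range_one⟩
  have hle : ∀ g : H, T.map (MulAut.conjNormal g : N ≃* N).toMonoidHom ≤ P := by
    intro g
    have hg := hT.map (MulAut.conjNormal g : N ≃* N)
    rcases hg.le_or_disjoint hP with h | hdis
    · exact h
    · exfalso
      let i : T →* N := (MulAut.conjNormal g : N ≃* N).toMonoidHom.comp T.subtype
      have hi : i.range = T.map (MulAut.conjNormal g : N ≃* N).toMonoidHom := by
        rw [MonoidHom.range_comp, T.range_subtype]
      have hcomm : ∀ x y, Commute (i x) (f y) := fun x y =>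
        Subgroup.commute_of_normal_of_disjoint _ _ hg.1 hP hdis _ _ (hi ▸ ⟨x, rfl⟩)
          (hfP ▸ ⟨y, rfl⟩)
      let c : (Fin (k + 1) → T) ≃* T × (Fin k → T) :=
        { (Fin.consEquiv fun _ => T).symm with map_mul' := fun _ _ => rfl }
      have hmem : T.map (MulAut.conjNormal g : N ≃* N).toMonoidHom ⊔ P ∈ S := by
        have := hg.1
        refine ⟨inferInstance, k + 1, (i.noncommCoprod f hcomm).comp c.toMonoidHom, ?_, ?_⟩
        · have hinj : Function.Injective (i.noncommCoprod f hcomm) :=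
            (MonoidHom.noncommCoprod_injective _ _ _).2
              ⟨(MulAut.conjNormal g : N ≃* N).injective.comp T.subtype_injective, hf,
                by rwa [hi, hfP]⟩
          exact hinj.comp c.injective
        · rw [MonoidHom.range_comp, MonoidHom.range_eq_top.2 c.surjective,
            ← MonoidHom.range_eq_map, MonoidHom.noncommCoprod_range, hi, hfP]
      have h2 := hmax hmem le_sup_right
      exact hg.2.1 (disjoint_self.1 (hdis.mono_right (le_sup_left.trans h2)))
  have htop : P = ⊤ := by
    rw [eq_top_iff, ← hN.iSup_conj_eq_top hT.2.1]
    exact iSup_le hle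
  refine ⟨k, hsimple, ?_, ⟨(MulEquiv.ofBijective f ⟨hf, ?_⟩).symm⟩⟩
  · rw [Nat.one_le_iff_ne_zero]
    rintro rfl
    refine bot_ne_top (α := Subgroup N) ?_
    rw [← htop, ← hfP, eq_comm, eq_bot_iff]
    rintro _ ⟨x, rfl⟩
    rw [Subsingleton.elim x 1, map_one]
    exact Subgroup.one_mem _
  · rw [← MonoidHom.range_eq_top, hfP, htop]

end MinimalNormal

/-! ### Normal subgroups of groups with 2-groups as point stabilizers -/

section TwoGroups

variable {V G : Type*} [Group G] [MulAction G V]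

/-- Write `k ^ 2 • v = m • v` with `m` in `M`. As `m` and `k` commute, a power of 2 that kills
`m⁻¹ * k ^ 2`, an element of a point stabilizer, takes `k ^ 2` into `M ⊓ K`. -/
lemma isPGroup_two_of_disjoint [Nonempty V]
    (hstab : ∀ (g : G) (v : V), g • v = v → ∃ n : ℕ, g ^ 2 ^ n = 1)
    {M K : Subgroup G} (hM : M.Normal) (hK : K.Normal) (hd : Disjoint M K)
    (horb : ∀ k ∈ K, ∀ v : V, ∃ m ∈ M, m • v = k ^ 2 • v) : IsPGroup 2 K := by
  rintro ⟨k, hk⟩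
  obtain ⟨v⟩ := ‹Nonempty V›
  obtain ⟨m, hm, hmv⟩ := horb k hk v
  have hk2 : k ^ 2 ∈ K := K.pow_mem hk 2
  have hc : Commute m⁻¹ (k ^ 2) :=
    Subgroup.commute_of_normal_of_disjoint _ _ hM hK hd _ _ (M.inv_mem hm) hk2
  obtain ⟨n, hn⟩ := hstab (m⁻¹ * k ^ 2) v (by rw [mul_smul, ← hmv, inv_smul_smul])
  rw [hc.mul_pow, inv_pow, inv_mul_eq_one] at hn
  have h1 : (k ^ 2) ^ 2 ^ n = 1 := by
    have : (k ^ 2) ^ 2 ^ n ∈ M ⊓ K := ⟨hn ▸ M.pow_mem hm _, K.pow_mem hk2 _⟩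
    rwa [hd.eq_bot, Subgroup.mem_bot] at this
  refine ⟨n + 1, Subtype.ext ?_⟩
  rw [pow_succ', pow_mul]
  exact h1

lemma isPGroup_two_of_orbits [Nonempty V]
    (hstab : ∀ (g : G) (v : V), g • v = v → ∃ n : ℕ, g ^ 2 ^ n = 1)
    {M K : Subgroup G} (hM : M.Normal) (hM2 : IsPGroup 2 M)
    (horb : ∀ k ∈ K, ∀ v : V, ∃ m ∈ M, m • v = k • v) : IsPGroup 2 K := by
  rintro ⟨k, hk⟩
  obtain ⟨v⟩ := ‹Nonempty V›
  obtain ⟨m, hm, hmv⟩ := horb k hk v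
  obtain ⟨n, hn⟩ := hstab (m⁻¹ * k) v (by rw [mul_smul, ← hmv, inv_smul_smul])
  have hmem : k ^ 2 ^ n ∈ M := by
    rw [← QuotientGroup.eq_one_iff, QuotientGroup.mk_pow]
    have := congrArg (QuotientGroup.mk (s := M)) hn
    rwa [QuotientGroup.mk_pow, QuotientGroup.mk_mul, QuotientGroup.mk_inv,
      (QuotientGroup.eq_one_iff m).2 hm, inv_one, one_mul, QuotientGroup.mk_one] at this
  obtain ⟨l, hl⟩ := hM2 ⟨_, hmem⟩
  refine ⟨n + l, Subtype.ext ?_⟩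
  have := congrArg Subtype.val hl
  rw [pow_add, pow_mul]
  exact this

/-- A finite normal 2-subgroup of a faithful group is commutative if its nontrivial subgroups that
are normal in the whole group have the same orbits: this applies to its centre. -/
lemma commute_of_isPGroup_two [Finite G] (hfaith : ∀ g : G, (∀ v : V, g • v = v) → g = 1)
    {K : Subgroup G} (hK : K.Normal) (hK2 : IsPGroup 2 K)
    (horb : ∀ M : Subgroup G, M.Normal → M ≠ ⊥ → M ≤ K → ∀ k ∈ K, ∀ v : V, ∃ m ∈ M, m • v = k • v) :
    ∀ a ∈ K, ∀ b ∈ K, a * b = b * a := by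
  rcases subsingleton_or_nontrivial K with hs | hs
  · intro a ha b hb
    exact congrArg Subtype.val (Subsingleton.elim ((⟨a, ha⟩ : K) * ⟨b, hb⟩) (⟨b, hb⟩ * ⟨a, ha⟩))
  have := hK2.center_nontrivial
  have hc := horb ((Subgroup.center K).map K.subtype) inferInstance (by
    rw [Ne, Subgroup.map_eq_bot_iff_of_injective _ K.subtype_injective]
    exact (Subgroup.nontrivial_iff_ne_bot _).1 this) (Subgroup.map_subtype_le _)
  have hcomm : ∀ z ∈ (Subgroup.center K).map K.subtype, ∀ a ∈ K, a * z = z * a := by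
    rintro _ ⟨z, hz, rfl⟩ a ha
    exact congrArg Subtype.val (Subgroup.mem_center_iff.1 hz ⟨a, ha⟩)
  intro a ha b hb
  rw [← inv_mul_eq_one]
  refine hfaith _ fun v => ?_
  obtain ⟨y, hy, hya⟩ := hc a ha v
  obtain ⟨z, hz, hzb⟩ := hc b hb v
  have hyK : y ∈ K := Subgroup.map_subtype_le _ hy
  rw [mul_smul, inv_smul_eq_iff, mul_smul, mul_smul, ← hzb, ← hya, ← mul_smul, ← mul_smul,
    hcomm z hz a ha, hcomm y hy b hb, mul_smul, mul_smul, ← hya, ← hzb, ← mul_smul, ← mul_smul,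
    hcomm z hz y hyK]

end TwoGroups

/-! ### Orbits and kernels -/

section Kernels

variable {V : Type u} {Γ : SimpleGraph V} {G : Subgroup (Γ ≃g Γ)}

lemma finite_group [Finite V] : Finite G :=
  have : Finite (Γ ≃g Γ) := Finite.of_injective _ RelIso.toEquiv_injective
  inferInstance

lemma eq_one_of_smul (g : G) (h : ∀ v : V, g • v = v) : g = 1 :=
  Subtype.ext (RelIso.ext h)

lemma adj_smul (g : G) {v w : V} : Γ.Adj (g • v) (g • w) ↔ Γ.Adj v w :=
  (g : Γ ≃g Γ).map_adj_iff

lemma orbitOf_eq {N : Subgroup G} {a b : V} :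
    orbitOf N a = orbitOf N b ↔ ∃ n ∈ N, n • b = a := by
  refine Quotient.eq.trans ⟨?_, ?_⟩
  · rintro ⟨n, hn⟩
    exact ⟨n, n.2, hn⟩
  · rintro ⟨n, hn, hnb⟩
    exact ⟨⟨n, hn⟩, hnb⟩

lemma orbitOf_surjective (N : Subgroup G) : Function.Surjective (orbitOf N) :=
  Quotient.mk_surjective

lemma orbitOf_smul {N : Subgroup G} (hN : N.Normal) (g : G) {a b : V} :
    orbitOf N (g • a) = orbitOf N (g • b) ↔ orbitOf N a = orbitOf N b := by
  have key : ∀ (g : G) {a b : V}, orbitOf N a = orbitOf N b →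
      orbitOf N (g • a) = orbitOf N (g • b) := by
    intro g a b h
    obtain ⟨n, hn, rfl⟩ := orbitOf_eq.1 h
    exact orbitOf_eq.2 ⟨g * n * g⁻¹, hN.conj_mem n hn g, by simp [mul_smul]⟩
  exact ⟨fun h => by simpa using key g⁻¹ h, key g⟩

lemma le_orbitKernel (N : Subgroup G) : N ≤ orbitKernel N :=
  fun n hn _ => orbitOf_eq.2 ⟨n, hn, rfl⟩

lemma orbitKernel_normal {N : Subgroup G} (hN : N.Normal) : (orbitKernel N).Normal :=
  ⟨fun k hk g v => by
    rw [mul_smul, mul_smul, ← orbitOf_smul hN g⁻¹, inv_smul_smul]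
    exact hk _⟩

lemma orbitOf_eq_of_le {M N : Subgroup G} (h : M ≤ orbitKernel N) {a b : V}
    (hab : orbitOf M a = orbitOf M b) : orbitOf N a = orbitOf N b := by
  obtain ⟨m, hm, rfl⟩ := orbitOf_eq.1 hab
  exact h hm b

lemma mem_orbitKernel {N : Subgroup G} {g : G} :
    g ∈ orbitKernel N ↔ ∀ v : V, ∃ n ∈ N, n • v = g • v :=
  forall_congr' fun _ => orbitOf_eq

lemma sq_mem_orbitKernel_of_card_two {N : Subgroup G} (hN : N.Normal) (φ : Orbits N ≃ Fin 2)
    (g : G) : g ^ 2 ∈ orbitKernel N := by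
  intro v
  rw [pow_two, mul_smul]
  by_cases h : orbitOf N (g • v) = orbitOf N v
  · rw [(orbitOf_smul hN g).2 h, h]
  · have h' : orbitOf N (g • g • v) ≠ orbitOf N (g • v) := fun h' => h ((orbitOf_smul hN g).1 h')
    rw [← φ.injective.eq_iff] at h
    rw [← φ.injective.ne_iff] at h'
    apply φ.injective
    revert h h'
    generalize φ (orbitOf N v) = a
    generalize φ (orbitOf N (g • v)) = b
    generalize φ (orbitOf N (g • g • v)) = c
    revert a b c
    decide

/-- A four-valent graph is not a cycle. -/
lemma not_isCycleGraph_bot (h4 : ∀ v : V, (Γ.neighborSet v).ncard = 4) [Nonempty V] :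
    ¬ IsCycleGraph (quotientGraph (⊥ : Subgroup G)) := by
  rintro ⟨r, hr, ⟨φ⟩⟩
  obtain ⟨v⟩ := ‹Nonempty V›
  obtain ⟨n, rfl⟩ := Nat.exists_eq_add_of_le' (show 2 ≤ r by omega)
  let f : V → Fin (n + 2) := fun v => φ (orbitOf ⊥ v)
  have hinj : ∀ {a b : V}, orbitOf (⊥ : Subgroup G) a = orbitOf ⊥ b → a = b := by
    intro a b hab
    obtain ⟨m, hm, rfl⟩ := orbitOf_eq.1 hab
    rw [Subgroup.mem_bot.1 hm, one_smul]
  have hf : Function.Injective f := fun a b hab => hinj (φ.injective hab)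
  have hsub : f '' Γ.neighborSet v ⊆ {f v - 1, f v + 1} := by
    rintro _ ⟨w, hw, rfl⟩
    have hw : Γ.Adj v w := hw
    have h₁ : (quotientGraph (⊥ : Subgroup G)).Adj (orbitOf ⊥ v) (orbitOf ⊥ w) :=
      ⟨fun h => hw.ne (hinj h), v, w, rfl, rfl, hw⟩
    rw [← φ.map_adj_iff, SimpleGraph.cycleGraph_adj] at h₁
    change f v - f w = 1 ∨ f w - f v = 1 at h₁
    rcases h₁ with h₁ | h₁
    · left; rw [← h₁]; abel
    · right; rw [Set.mem_singleton_iff, ← h₁]; abel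
  have h₁ := Set.ncard_le_ncard hsub (Set.toFinite _)
  rw [Set.ncard_image_of_injective _ hf, h4] at h₁
  have h₂ := Set.ncard_insert_le (f v - 1) {f v + 1}
  rw [Set.ncard_singleton] at h₂
  omega

/-- Without independent cyclic normal quotients there is a least kernel `K` on a cyclic normal
quotient, and `K` is the kernel on its own orbits. -/
lemma exists_least_orbitKernel (h : IsBasicOrientedCycle Γ G) :
    ∃ K : Subgroup G, IsCyclicNormalQuotient K ∧ orbitKernel K = K ∧
      ∀ N : Subgroup G, IsCyclicNormalQuotient N → K ≤ orbitKernel N := by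
  obtain ⟨⟨⟨hV, hconn, h4, -⟩, -⟩, ⟨N₁, hN₁⟩, hind, -⟩ := h
  have := hconn.nonempty
  have : Finite G := finite_group
  obtain ⟨K, ⟨N₀, hN₀, rfl⟩, hmin⟩ :=
    (Set.toFinite {K : Subgroup G |
      ∃ N, IsCyclicNormalQuotient N ∧ orbitKernel N = K}).exists_minimal ⟨_, N₁, hN₁, rfl⟩
  have key : ∀ N : Subgroup G, IsCyclicNormalQuotient N →
      IsCyclicNormalQuotient (orbitKernel N₀ ⊓ orbitKernel N) ∧
      orbitKernel (orbitKernel N₀ ⊓ orbitKernel N) = orbitKernel N₀ ⊓ orbitKernel N := by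
    intro N hN
    have hcyc := not_not.1 (hind N₀ N hN₀ hN)
    have := orbitKernel_normal hN₀.1
    have := orbitKernel_normal hN.1
    refine ⟨⟨inferInstance, fun hbot => ?_, hcyc⟩, le_antisymm ?_ (le_orbitKernel _)⟩
    · rw [hbot] at hcyc
      exact not_isCycleGraph_bot h4 hcyc
    · exact fun g hg => ⟨fun v => orbitOf_eq_of_le inf_le_left (hg v),
        fun v => orbitOf_eq_of_le inf_le_right (hg v)⟩
  have hle : ∀ N : Subgroup G, IsCyclicNormalQuotient N → orbitKernel N₀ ≤ orbitKernel N :=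
    fun N hN => (hmin ⟨_, (key N hN).1, (key N hN).2⟩ inf_le_left).trans inf_le_right
  have h0 := key N₀ hN₀
  rw [inf_idem] at h0
  exact ⟨_, h0.1, h0.2, hle⟩

variable {K : Subgroup G}

/-- Nontrivial normal subgroups of `G` below the least kernel `K` have the orbits of `K`: their
quotients map onto the cycle `Γ_K`, hence are cycles themselves. -/
lemma exists_smul_eq_of_le (h : IsBasic Γ G) (hK : IsCyclicNormalQuotient K)
    (hmin : ∀ N : Subgroup G, IsCyclicNormalQuotient N → K ≤ orbitKernel N)
    {M : Subgroup G} (hM : M.Normal) (hM1 : M ≠ ⊥) (hMK : M ≤ K) :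
    ∀ k ∈ K, ∀ v : V, ∃ m ∈ M, m • v = k • v := by
  have := h.1.1
  suffices hcyc : IsCycleGraph (quotientGraph M) from
    fun k hk => mem_orbitKernel.1 (hmin M ⟨hM, hM1, hcyc⟩ hk)
  obtain ⟨-, -, r, hr, ⟨φ⟩⟩ := hK
  have hcard : 3 ≤ Nat.card (Orbits M) := by
    have h₁ : Function.Surjective
        (Quotient.map' id (fun a b hab => Quotient.exact (orbitOf_eq_of_le (hMK.trans
          (le_orbitKernel K)) (Quotient.sound hab))) : Orbits M → Orbits K) := by
      intro X
      obtain ⟨v, rfl⟩ := orbitOf_surjective K X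
      exact ⟨orbitOf M v, rfl⟩
    have h₂ : Nat.card (Orbits K) ≤ Nat.card (Orbits M) := Nat.card_le_card_of_surjective _ h₁
    rw [Nat.card_congr φ.toEquiv, Nat.card_fin] at h₂
    exact hr.trans h₂
  rcases h.2 M hM hM1 with ⟨⟨ψ⟩⟩ | ⟨⟨ψ⟩⟩ | hcyc
  · rw [Nat.card_congr ψ.toEquiv, Nat.card_fin] at hcard
    omega
  · rw [Nat.card_congr ψ.toEquiv, Nat.card_fin] at hcard
    omega
  · exact hcyc

/-- The squares of the elements of the least kernel `K` fix the orbits of every nontrivial normal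
subgroup `M`: either `Γ_M` has at most two vertices or it is a cycle with kernel above `K`. -/
lemma exists_smul_eq_sq (h : IsBasic Γ G)
    (hmin : ∀ N : Subgroup G, IsCyclicNormalQuotient N → K ≤ orbitKernel N)
    {M : Subgroup G} (hM : M.Normal) (hM1 : M ≠ ⊥) :
    ∀ k ∈ K, ∀ v : V, ∃ m ∈ M, m • v = k ^ 2 • v := by
  intro k hk
  rw [← mem_orbitKernel]
  rcases h.2 M hM hM1 with ⟨⟨ψ⟩⟩ | ⟨⟨ψ⟩⟩ | hcyc
  · exact fun v => ψ.injective (Subsingleton.elim _ _)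
  · exact sq_mem_orbitKernel_of_card_two hM ψ.toEquiv k
  · exact pow_mem (hmin M ⟨hM, hM1, hcyc⟩ hk) 2

end Kernels

/-! ### The orientation given by an oriented cyclic quotient -/

section Orientation

variable {V : Type u} {Γ : SimpleGraph V} {G : Subgroup (Γ ≃g Γ)} {K : Subgroup G}

/-- `A` is an orientation of the edges of `Γ` on whose arcs `G` acts transitively, and the arcs
follow the cycle of `K`-orbits. -/
structure IsCycleOrientation (K : Subgroup G) (A : V → V → Prop) : Prop where
  map_adj : ∀ (g : G) {v w : V}, A v w → A (g • v) (g • w)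
  adj_iff : ∀ v w : V, Γ.Adj v w ↔ A v w ∨ A w v
  asymm : ∀ {v w : V}, A v w → ¬ A w v
  trans : ∀ {a b c d : V}, A a b → A c d → ∃ g : G, g • a = c ∧ g • b = d
  pred : ∀ {v v' w : V}, A v w → A v' w → orbitOf K v = orbitOf K v'
  stab : ∀ {g : G} {v : V}, g • v = v → g ∈ orbitKernel K

lemma exists_isCycleOrientation (hG : MemOG Γ G 4) (hK : IsOrientedCyclicQuotient K) :
    ∃ A : V → V → Prop, IsCycleOrientation K A := by
  obtain ⟨-, -, -, -, hE, -⟩ := hG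
  obtain ⟨r, hr, φ, hrot, -⟩ := hK
  obtain ⟨n, rfl⟩ := Nat.exists_eq_add_of_le' hr
  let f : V → Fin (n + 3) := fun v => φ (orbitOf K v)
  have hrot' : ∀ g : G, ∃ c, ∀ v, f (g • v) = f v + c := hrot
  let A : V → V → Prop := fun v w => Γ.Adj v w ∧ f w = f v + 1
  have hmap : ∀ (g : G) {v w : V}, A v w → A (g • v) (g • w) := by
    rintro g v w ⟨h₁, h₂⟩
    obtain ⟨c, hc⟩ := hrot' g
    exact ⟨(adj_smul g).2 h₁, by rw [hc, hc, h₂]; abel⟩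
  have hasymm : ∀ {v w : V}, A v w → ¬ A w v := by
    rintro v w ⟨-, h₁⟩ ⟨-, h₂⟩
    rw [h₁, add_assoc, left_eq_add] at h₂
    have := congrArg Fin.val h₂
    simp only [Fin.val_add, Fin.val_one, Fin.val_zero] at this
    rw [Nat.mod_eq_of_lt (by omega)] at this
    omega
  -- some edge joins two `K`-orbits, so all edges do
  have hne : ∀ {v w : V}, Γ.Adj v w → f v ≠ f w := by
    intro v w hvw
    have h01 : (SimpleGraph.cycleGraph (n + 3)).Adj 0 1 := by
      rw [SimpleGraph.cycleGraph_adj (n := n + 1)]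
      right
      exact sub_zero _
    rw [← φ.apply_symm_apply 0, ← φ.apply_symm_apply 1, φ.map_adj_iff] at h01
    obtain ⟨h₁, a, b, ha, hb, hab⟩ := h01
    obtain ⟨g, hg⟩ := hE a b v w hab hvw
    obtain ⟨c, hc⟩ := hrot' g
    have h₂ : f (g • a) ≠ f (g • b) := by
      rw [hc, hc, Ne, add_left_inj]
      exact fun h => h₁ (ha ▸ hb ▸ φ.injective h)
    rcases Sym2.eq_iff.1 hg with ⟨rfl, rfl⟩ | ⟨rfl, rfl⟩
    exacts [h₂, h₂.symm]
  have hadj : ∀ v w : V, Γ.Adj v w ↔ A v w ∨ A w v := by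
    intro v w
    refine ⟨fun h => ?_, fun h => h.elim And.left fun h => h.1.symm⟩
    have h₁ : (quotientGraph K).Adj (orbitOf K v) (orbitOf K w) :=
      ⟨fun h' => hne h (congrArg φ h'), v, w, rfl, rfl, h⟩
    rw [← φ.map_adj_iff, SimpleGraph.cycleGraph_adj (n := n + 1)] at h₁
    rcases h₁ with h₁ | h₁
    · exact Or.inr ⟨h.symm, (sub_eq_iff_eq_add'.1 h₁)⟩
    · exact Or.inl ⟨h, (sub_eq_iff_eq_add'.1 h₁)⟩
  refine ⟨A, hmap, hadj, hasymm, ?_, ?_, ?_⟩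
  · intro a b c d hab hcd
    obtain ⟨g, hg⟩ := hE a b c d hab.1 hcd.1
    rcases Sym2.eq_iff.1 hg with h | ⟨h₁, h₂⟩
    · exact ⟨g, h⟩
    · have := hmap g hab
      rw [h₁, h₂] at this
      exact absurd this (hasymm hcd)
  · rintro v v' w ⟨-, h₁⟩ ⟨-, h₂⟩
    exact φ.injective (add_right_cancel (h₁.symm.trans h₂))
  · intro g v hg w
    obtain ⟨c, hc⟩ := hrot' g
    have := hc v
    rw [hg, left_eq_add] at this
    apply φ.injective
    have h₁ := hc w
    rwa [this, add_zero] at h₁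

namespace IsCycleOrientation

variable {A : V → V → Prop}

/-- Every vertex has two out-neighbours and two in-neighbours: both numbers do not depend on the
vertex, their sum is 4, and on average they agree. -/
lemma ncard_out_in (hA : IsCycleOrientation K A) (hG : MemOG Γ G 4) (v : V) :
    {w | A v w}.ncard = 2 ∧ {w | A w v}.ncard = 2 := by
  classical
  obtain ⟨hV, -, h4, hT, -, -⟩ := hG
  have := Fintype.ofFinite V
  have hconst : ∀ B : V → V → Prop, (∀ (g : G) {v w : V}, B v w → B (g • v) (g • w)) →
      ∀ w, {x | B w x}.ncard = {x | B v x}.ncard := by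
    intro B hB w
    obtain ⟨g, rfl⟩ := hT w v
    rw [← Set.ncard_image_of_injective _ (MulAction.injective g)]
    congr 1
    ext x
    refine ⟨?_, fun (hx : B (g • w) x) => ⟨g⁻¹ • x, ?_, smul_inv_smul g x⟩⟩
    · rintro ⟨y, hy, rfl⟩
      exact hB g hy
    · have := hB g⁻¹ hx
      rwa [inv_smul_smul] at this
  have hout := hconst A hA.map_adj
  have hin := hconst (fun x y => A y x) fun g _ _ => hA.map_adj g
  have hsum : {w | A v w}.ncard + {w | A w v}.ncard = 4 := by
    rw [← h4 v, ← Set.ncard_union_eq (s := {w | A v w}) (t := {w | A w v})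
      (Set.disjoint_left.2 fun w h₁ h₂ => hA.asymm h₁ h₂)]
    congr 1
    ext w
    exact (hA.adj_iff v w).symm
  have hdc := Finset.sum_card_bipartiteAbove_eq_sum_card_bipartiteBelow
    (s := Finset.univ) (t := Finset.univ) A
  have h₁ : ∀ w, (Finset.bipartiteAbove A Finset.univ w).card = {x | A v x}.ncard := fun w => by
    rw [← hout w, Set.ncard_eq_toFinset_card']
    congr 1
    ext x
    simp [Finset.bipartiteAbove]
  have h₂ : ∀ w, (Finset.bipartiteBelow A Finset.univ w).card = {x | A x v}.ncard := fun w => by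
    rw [← hin w, Set.ncard_eq_toFinset_card']
    congr 1
    ext x
    simp [Finset.bipartiteBelow]
  simp only [h₁, h₂, Finset.sum_const, smul_eq_mul] at hdc
  have hpos : 0 < (Finset.univ : Finset V).card := Finset.card_pos.2 ⟨v, Finset.mem_univ v⟩
  have := Nat.eq_of_mul_eq_mul_left hpos hdc
  omega

/-- An element fixing a vertex permutes its two out-neighbours and its two in-neighbours. -/
lemma sq_smul_eq (hA : IsCycleOrientation K A) (hG : MemOG Γ G 4) {g : G} {v w : V}
    (hv : g • v = v) (hvw : Γ.Adj v w) : g ^ 2 • w = w := by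
  have key : ∀ S : Set V, S.ncard = 2 → (∀ x ∈ S, g • x ∈ S) → w ∈ S → g ^ 2 • w = w := by
    intro S hS hgS hw
    obtain ⟨a, b, -, rfl⟩ := Set.ncard_eq_two.1 hS
    have h₁ := hgS w hw
    have h₂ := hgS _ h₁
    rw [pow_two, mul_smul]
    have hinj := MulAction.injective (β := V) g
    by_cases h : g • w = w
    · rw [h, h]
    · have h' : g • g • w ≠ g • w := fun h' => h (hinj h')
      simp only [Set.mem_insert_iff, Set.mem_singleton_iff] at hw h₁ h₂
      grind
  rcases (hA.adj_iff v w).1 hvw with h | h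
  · exact key {w | A v w} (hA.ncard_out_in hG v).1
      (fun x (hx : A v x) => by simpa [hv] using hA.map_adj g hx) h
  · exact key {w | A w v} (hA.ncard_out_in hG v).2
      (fun x (hx : A x v) => by simpa [hv] using hA.map_adj g hx) h

/-- Vertex stabilizers are 2-groups. -/
lemma exists_pow_two_pow_eq_one (hA : IsCycleOrientation K A) (hG : MemOG Γ G 4) (g : G) (v : V)
    (hv : g • v = v) : ∃ n : ℕ, g ^ 2 ^ n = 1 := by
  have hfin : Finite V := hG.1
  have hw : ∀ w : V, ∃ n : ℕ, g ^ 2 ^ n • w = w := by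
    intro w
    obtain ⟨p⟩ := hG.2.1.preconnected w v
    induction p with
    | nil => exact ⟨0, by simpa using hv⟩
    | cons hadj _ ih =>
      obtain ⟨n, hn⟩ := ih hv
      refine ⟨n + 1, ?_⟩
      rw [pow_succ, pow_mul]
      exact hA.sq_smul_eq hG hn hadj.symm
  choose n hn using hw
  have := Fintype.ofFinite V
  refine ⟨Finset.univ.sup n, eq_one_of_smul _ fun w => ?_⟩
  obtain ⟨c, hc⟩ := Nat.exists_eq_add_of_le (Finset.le_sup (f := n) (Finset.mem_univ w))
  have hfix : g ^ 2 ^ n w ∈ MulAction.stabilizer G w := hn w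
  rw [hc, pow_add, pow_mul]
  exact MulAction.mem_stabilizer_iff.1 (pow_mem hfix _)

lemma swapDigraph (hA : IsCycleOrientation K A) (hG : MemOG Γ G 4) (hKK : orbitKernel K = K)
    (hcomm : ∀ a ∈ K, ∀ b ∈ K, a * b = b * a) : SwapDigraph A K where
  map_adj := hA.map_adj
  trans := hG.2.2.2.1
  comm := hcomm
  swap hw hw' := by
    obtain ⟨g, hg, hgw⟩ := hA.trans hw hw'
    exact ⟨g, hKK ▸ hA.stab hg, hg, hgw⟩
  pred hv hv' := orbitOf_eq.1 (hA.pred hv' hv)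
  out v := by
    obtain ⟨w, w', -, h⟩ := Set.ncard_eq_two.1 (hA.ncard_out_in hG v).1
    exact ⟨w, w', fun x => Set.ext_iff.1 h x⟩
  conn v w := by
    obtain ⟨p⟩ := hG.2.1.preconnected v w
    induction p with
    | nil => exact .refl _
    | cons hadj _ ih =>
      refine .trans _ _ _ ?_ ih
      exact ((hA.adj_iff _ _).1 hadj).elim (.rel _ _) fun h => .symm _ _ (.rel _ _ h)

/-- The parameters satisfy `3 ≤ r` and `1 ≤ t` because `Γ` has no loops, the orientation is
asymmetric and out-valencies are 2. -/
lemma exists_iso (hA : IsCycleOrientation K A) (hG : MemOG Γ G 4) (hKK : orbitKernel K = K)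
    (hcomm : ∀ a ∈ K, ∀ b ∈ K, a * b = b * a) :
    ∃ r t : ℕ, 3 ≤ r ∧ 1 ≤ t ∧ Nonempty (Γ ≃g cycleDigraphUnderlying r 2 t) := by
  have := hG.1
  have := hG.2.1.nonempty
  obtain ⟨r, t, hr, e, he⟩ := (hA.swapDigraph hG hKK hcomm).exists_equiv
  have he' : ∀ i : ZMod r, A (e.symm (i, 0)) (e.symm (i + 1, 0)) := fun i => by
    rw [he, e.apply_symm_apply, e.apply_symm_apply]
    exact ⟨rfl, fun _ _ _ => rfl⟩
  have hr3 : 3 ≤ r := by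
    by_contra hlt
    have h₁ := he' 0
    have h₂ := he' (0 + 1)
    have h0 : (0 + 1 + 1 : ZMod r) = 0 := by
      obtain rfl | rfl : r = 1 ∨ r = 2 := by omega
      all_goals rfl
    rw [h0] at h₂
    exact hA.asymm h₁ h₂
  have ht : 1 ≤ t := by
    by_contra hlt
    obtain rfl : t = 0 := by omega
    obtain ⟨w, w', hne, h⟩ := Set.ncard_eq_two.1 (hA.ncard_out_in hG (e.symm (0, 0))).1
    have h₁ := (he _ _).1 ((Set.ext_iff.1 h w).2 (Or.inl rfl))
    have h₂ := (he _ _).1 ((Set.ext_iff.1 h w').2 (Or.inr rfl))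
    exact hne (e.injective (Prod.ext (h₁.1.trans h₂.1.symm) (Subsingleton.elim _ _)))
  refine ⟨r, t, hr3, ht, ⟨⟨e, ?_⟩⟩⟩
  intro v w
  change (SimpleGraph.fromRel (cycleDigraph r 2 t).Adj).Adj (e v) (e w) ↔ _
  rw [SimpleGraph.fromRel_adj, ← he, ← he, ← hA.adj_iff, e.injective.ne_iff]
  exact and_iff_right_of_imp fun h => h.ne

end IsCycleOrientation

end Orientation

end OG4

/-! ### The dichotomy -/

theorem mainTheorem3 {V : Type u} (Γ : SimpleGraph V) (G : Subgroup (Γ ≃g Γ))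
    (h : OG4.IsBasicOrientedCycle Γ G) :
    (∃ r t : ℕ, 3 ≤ r ∧ 1 ≤ t ∧ Nonempty (Γ ≃g OG4.cycleDigraphUnderlying r 2 t)) ∨
    (∃ N : Subgroup G, OG4.IsMinimalNormal N ∧
      (∀ M : Subgroup G, OG4.IsMinimalNormal M → M = N) ∧
      ∃ (T : Type u) (_ : Group T) (k : ℕ), IsSimpleGroup T ∧
        IsEmpty (T ≃* Multiplicative (ZMod 2)) ∧ 1 ≤ k ∧ Nonempty (N ≃* (Fin k → T))) := by
  open OG4 in
  obtain ⟨K, hK, hKK, hmin⟩ := exists_least_orbitKernel h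
  obtain ⟨hbasic, -, -, hor⟩ := h
  have hG := hbasic.1
  have := hG.1
  have := hG.2.1.nonempty
  have : Finite G := finite_group
  obtain ⟨A, hA⟩ := exists_isCycleOrientation hG (hor K hK)
  have hstab := hA.exists_pow_two_pow_eq_one hG
  have horb := fun (M : Subgroup G) => exists_smul_eq_of_le (M := M) hbasic hK hmin
  by_cases hK2 : IsPGroup 2 K
  · exact Or.inl (hA.exists_iso hG hKK (commute_of_isPGroup_two eq_one_of_smul hK.1 hK2 horb))
  right
  have hle : ∀ M : Subgroup G, IsMinimalNormal M → M ≤ K := fun M hM =>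
    (hM.le_or_disjoint hK.1).resolve_right fun hd =>
      hK2 (isPGroup_two_of_disjoint hstab hM.1 hK.1 hd (exists_smul_eq_sq hbasic hmin hM.1 hM.2.1))
  have hnot2 : ∀ M : Subgroup G, IsMinimalNormal M → ¬ IsPGroup 2 M := fun M hM hM2 =>
    hK2 (isPGroup_two_of_orbits hstab hM.1 hM2 (horb M hM.1 hM.2.1 (hle M hM)))
  obtain ⟨N, hN, -⟩ := exists_isMinimalNormal_le hK.1 hK.2.1
  refine ⟨N, hN, fun M hM => ?_, ?_⟩
  · rcases hM.le_or_disjoint hN.1 with hMN | hd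
    · exact hN.2.2 M hM.1 hM.2.1 hMN
    · refine absurd (isPGroup_two_of_disjoint hstab hM.1 hN.1 hd fun n hn => ?_) (hnot2 N hN)
      exact horb M hM.1 hM.2.1 (hle M hM) _ (pow_mem (hle N hN hn) 2)
  · obtain ⟨T, hT, k, hsimple, hk, ⟨f⟩⟩ := hN.exists_mulEquiv_pi
    refine ⟨T, hT, k, hsimple, ⟨fun c => hnot2 N hN fun n => ⟨1, f.injective ?_⟩⟩, hk, ⟨f⟩⟩
    have hz : ∀ z : Multiplicative (ZMod 2), z ^ 2 = 1 := by decide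
    have ht : ∀ t : T, t ^ 2 = 1 := fun t => c.injective (by rw [map_pow, hz, map_one])
    rw [map_pow, map_one]
    exact funext fun i => ht _
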